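/- Let $d\ge 1$ be an integer, let $\upsilon,\lambda_b,\alpha,\mu,\Omega>0$ and put $\delta=d/\upsilon$. Let the locations $x_1,x_2,\dots$ of the legitimate users be an enumeration of the points of a homogeneous Poisson point process of density $\lambda_b$ in $\mathbb{R}^d$, and let the channel power gains $g_1,g_2,\dots$ of these users be i.i.d., independent of the locations, with the $\alpha$-$\mu$ fading density $$f_g(x)=\frac{\alpha\,x^{\alpha\mu/2-1}}{2\,\Omega^{\alpha\mu/2}\,\Gamma(\mu)}\exp\left(-\left(\frac{x}{\Omega}\right)^{\alpha/2}\right),\qquad x>0.$$ Then almost surely the values $\lVert x_i\rVert^{\upsilon}/g_i$, $i\ge 1$, are pairwise distinct and can be arranged in a strictly increasing sequence $\xi_1<\xi_2<\xi_3<\cdots$, so that $1/\xi_k$ is the composite channel gain $g/r^{\upsilon}$ of the $k$-th best user (here $r$ is the user's distance from the origin). For every integer $k\ge 1$ the random variable $1/\xi_k$ has, for $z>0$, the probability density function $$f_{1/\xi_k}(z)=\exp\left(-A_{b1}z^{-\delta}\right)\frac{\delta\,(A_{b1}z^{-\delta})^k}{z\,\Gamma(k)}$$ and the cumulative distribution function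 $$F_{1/\xi_k}(z)=\frac{\Gamma(k,A_{b1}z^{-\delta})}{\Gamma(k)},$$ and both vanish for $z\le 0$. Here $\Gamma(a,x)=\int_x^\infty t^{a-1}e^{-t}\,dt$ is the upper incomplete gamma function and $$A_{b1}=\frac{A_{b0}}{\delta},\qquad A_{b0}=\frac{\lambda_b\,c_d\,\delta\,\Omega^{\delta}\,\Gamma\left(\mu+\frac{2\delta}{\alpha}\right)}{\Gamma(\mu)},\qquad c_d=\frac{\pi^{d/2}}{\Gamma(1+d/2)}.$$ -/

import Mathlib

open MeasureTheory ProbabilityTheory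
open scoped ENNReal NNReal

noncomputable section

/-- Number of indices `i` for which the random point `x i` lies in `B` (points are counted with
multiplicity; the value is `⊤` if there are infinitely many). -/
def pointCount {Ω E : Type*} (x : ℕ → Ω → E) (B : Set E) (ω : Ω) : ℕ∞ :=
  {i : ℕ | x i ω ∈ B}.encard

/-- The random points `x 0, x 1, …` are an enumeration of a homogeneous Poisson point process of
density `lam` in `d`-dimensional Euclidean space: the number of points in a measurable set of finite
volume is Poisson distributed with mean `lam * volume B`, and the numbers of points in finitely many
pairwise disjoint such sets are independent. -/
structure IsHomogeneousPoisson {Ω : Type*} [MeasurableSpace Ω] (P : Measure Ω) {d : ℕ}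
    (lam : ℝ) (x : ℕ → Ω → EuclideanSpace ℝ (Fin d)) : Prop where
  measurable : ∀ i, Measurable (x i)
  poisson : ∀ B : Set (EuclideanSpace ℝ (Fin d)), MeasurableSet B → volume B ≠ ∞ → ∀ n : ℕ,
    P {ω | pointCount x B ω = n} = poissonMeasure (lam * (volume B).toReal).toNNReal {n}
  indep : ∀ (m : ℕ) (B : Fin m → Set (EuclideanSpace ℝ (Fin d))),
    (∀ j, MeasurableSet (B j)) → (∀ j, volume (B j) ≠ ∞) → Pairwise (Function.onFun Disjoint B) →
    iIndepFun (fun j => pointCount x (B j)) P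

/-- Density of the channel power gain under `α`-`μ` fading with scale `Om`. -/
def alphaMuGainPDF (α μ Om : ℝ) (x : ℝ) : ℝ :=
  if 0 < x then
    α * x ^ (α * μ / 2 - 1) / (2 * Om ^ (α * μ / 2) * Real.Gamma μ)
      * Real.exp (-(x / Om) ^ (α / 2))
  else 0

/-- Law of the channel power gain under `α`-`μ` fading with scale `Om`. -/
def alphaMuGainLaw (α μ Om : ℝ) : Measure ℝ :=
  volume.withDensity fun x => ENNReal.ofReal (alphaMuGainPDF α μ Om x)

/-- The network of legitimate users: user `i` sits at `x i` and has channel power gain `g i`.  The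
locations form a homogeneous Poisson process of density `lam`, the gains are independent and
identically distributed with the `α`-`μ` law, and they are independent of the locations. -/
structure IsFadingNetwork {Ω : Type*} [MeasurableSpace Ω] (P : Measure Ω) {d : ℕ}
    (lam α μ Om : ℝ) (x : ℕ → Ω → EuclideanSpace ℝ (Fin d)) (g : ℕ → Ω → ℝ) : Prop where
  locations : IsHomogeneousPoisson P lam x
  gain_measurable : ∀ i, Measurable (g i)
  gain_law : ∀ i, P.map (g i) = alphaMuGainLaw α μ Om
  gain_indep : iIndepFun g P
  indep : IndepFun (fun ω i => x i ω) (fun ω i => g i ω) P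

/-- Path loss with fading `r ^ υ / g` of user `i`, where `r` is the distance from the transmitter
(the origin) to the user; its inverse `g / r ^ υ` is the composite channel gain. -/
def fadedPathLoss {Ω : Type*} {d : ℕ} (υ : ℝ) (x : ℕ → Ω → EuclideanSpace ℝ (Fin d))
    (g : ℕ → Ω → ℝ) (i : ℕ) (ω : Ω) : ℝ :=
  ‖x i ω‖ ^ υ / g i ω

/-- The `k`-th smallest value (`k = 1, 2, …`) of a real sequence, counted with multiplicity: the
least `t` such that at least `k` terms are `≤ t`. -/
def kthSmallest (s : ℕ → ℝ) (k : ℕ) : ℝ :=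
  sInf {t : ℝ | (k : ℕ∞) ≤ {i : ℕ | s i ≤ t}.encard}

/-- `ξ_k`: the `k`-th smallest path loss with fading, i.e. that of the `k`-th best user. -/
def bestPathLoss {Ω : Type*} {d : ℕ} (υ : ℝ) (x : ℕ → Ω → EuclideanSpace ℝ (Fin d))
    (g : ℕ → Ω → ℝ) (k : ℕ) (ω : Ω) : ℝ :=
  kthSmallest (fun i => fadedPathLoss υ x g i ω) k

/-- Upper incomplete gamma function `Γ(a, x) = ∫_x^∞ t^(a-1) e^(-t) dt`. -/
def upperIncompleteGamma (a x : ℝ) : ℝ :=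
  ∫ t in Set.Ioi x, t ^ (a - 1) * Real.exp (-t)

/-- `c_d = π^(d/2) / Γ(1 + d/2)`. -/
def unitBallVolume (d : ℕ) : ℝ :=
  Real.pi ^ ((d : ℝ) / 2) / Real.Gamma (1 + (d : ℝ) / 2)

/-- `A_{b0}`, with `δ = d / υ`. -/
def Ab0 (d : ℕ) (υ lam α μ Om : ℝ) : ℝ :=
  lam * unitBallVolume d * (d / υ) * Om ^ (d / υ) * Real.Gamma (μ + 2 * (d / υ) / α)
    / Real.Gamma μ

/-- `A_{b1} = A_{b0} / δ`, with `δ = d / υ`. -/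
def Ab1 (d : ℕ) (υ lam α μ Om : ℝ) : ℝ :=
  Ab0 d υ lam α μ Om / (d / υ)

/-- Density of the composite channel gain of the `k`-th best user, with `A = A_{b1}`. -/
def bestGainPDF (A δ : ℝ) (k : ℕ) (z : ℝ) : ℝ :=
  if 0 < z then
    Real.exp (-A * z ^ (-δ)) * (δ * (A * z ^ (-δ)) ^ k / (z * Real.Gamma k))
  else 0

/-- Distribution function of the composite channel gain of the `k`-th best user, with
`A = A_{b1}`. -/
def bestGainCDF (A δ : ℝ) (k : ℕ) (z : ℝ) : ℝ :=
  if 0 < z then upperIncompleteGamma k (A * z ^ (-δ)) / Real.Gamma k else 0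

end

noncomputable section

open Filter Topology

/-! Let N(t) be the number of users with faded path loss below t. Everything reduces to N(t) being
Poisson with mean `Ab1` * t^δ: since 1/ξ_k ≤ z exactly when N(1/z) < k, the distribution function is
a partial sum of Poisson weights, which is a normalised incomplete gamma function
(`poissonCDFBelow_eq_upperIncompleteGamma`), and differentiating it gives the density.

The law of N(t) comes from the marking theorem (`IsHomogeneousPoisson.measure_encard_marked_eq`),
proved through E v^N. Given the locations, independence of the gains turns E v^N into a product of 1
- (1 - v) p(x_i), where p(y) is the probability that a user at y is counted. The generating
functional (`IsHomogeneousPoisson.lintegral_prod`) evaluates its mean as exp(-(1 - v) lam ∫ p), and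
uniqueness of power series identifies the law. The functional itself is computed for simple
functions from independent Poisson counts on level sets, then extended by monotone limits.

For the mean, integrate over space first: a gain r contributes the volume of a ball, c_d (t r)^δ, so
the fading enters only through E g^δ (`lintegral_rpow_alphaMuGainLaw`).

The ordering statement needs that almost surely no two path losses tie, because the gain law has no
atoms, and that only finitely many lie below any level, because N(t) is Poisson. -/

/-- `a ^ n` for an extended natural number `n`, with the value `0` at `n = ⊤`. -/
def powCount (a : ℝ≥0∞) (n : ℕ∞) : ℝ≥0∞ := if n = ⊤ then 0 else a ^ n.toNat

/-- The function `x ↦ exp (-x)` from extended nonnegative reals, for finite `x`. -/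
def expNeg (x : ℝ≥0∞) : ℝ≥0∞ := ENNReal.ofReal (Real.exp (-x.toReal))

lemma expNeg_zero : expNeg 0 = 1 := by simp [expNeg]

lemma expNeg_add {x y : ℝ≥0∞} (hx : x ≠ ∞) (hy : y ≠ ∞) :
    expNeg (x + y) = expNeg x * expNeg y := by
  rw [expNeg, expNeg, expNeg, ENNReal.toReal_add hx hy, neg_add, Real.exp_add,
    ENNReal.ofReal_mul (Real.exp_nonneg _)]

lemma expNeg_sum {ι : Type*} (s : Finset ι) (f : ι → ℝ≥0∞) (hf : ∀ i ∈ s, f i ≠ ∞) :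
    expNeg (∑ i ∈ s, f i) = ∏ i ∈ s, expNeg (f i) := by
  classical
  induction s using Finset.induction_on with
  | empty => simp [expNeg_zero]
  | insert a s ha ih =>
    rw [Finset.sum_insert ha, Finset.prod_insert ha, expNeg_add (hf a (by simp)), ih]
    · exact fun i hi => hf i (by simp [hi])
    · exact ENNReal.sum_ne_top.2 fun i hi => hf i (by simp [hi])

lemma tendsto_expNeg {f : ℕ → ℝ≥0∞} {a : ℝ≥0∞} (ha : a ≠ ∞) (hf : Tendsto f atTop (𝓝 a)) :
    Tendsto (fun n => expNeg (f n)) atTop (𝓝 (expNeg a)) := by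
  unfold expNeg
  refine ENNReal.tendsto_ofReal ((Real.continuous_exp.tendsto _).comp ?_)
  exact ((ENNReal.tendsto_toReal ha).comp hf).neg

lemma powCount_eq_tsum (a : ℝ≥0∞) (n : ℕ∞) :
    powCount a n = ∑' m : ℕ, if n = m then a ^ m else 0 := by
  induction n using ENat.recTopCoe with
  | top => simp [powCount]
  | coe n =>
    rw [tsum_eq_single n]
    · simp [powCount]
    · intro m hm
      simp [hm.symm]

/-! ### Counting variables and the Poisson generating function -/

section Count

variable {Ω : Type*} [MeasurableSpace Ω]

/-- The count is a countable sum of indicators in `ℝ≥0∞`; measurability is pulled back to `ℕ∞` on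
singletons of finite values. -/
lemma measurable_encard_setOf_mem {A : ℕ → Set Ω} (hA : ∀ i, MeasurableSet (A i)) :
    Measurable fun ω => {i : ℕ | ω ∈ A i}.encard := by
  have h : Measurable fun ω => (({i : ℕ | ω ∈ A i}.encard : ℕ∞) : ℝ≥0∞) := by
    have : (fun ω => (({i : ℕ | ω ∈ A i}.encard : ℕ∞) : ℝ≥0∞)) =
        fun ω => ∑' i : ℕ, (A i).indicator 1 ω := by
      ext ω
      rw [← ENNReal.tsum_set_one, tsum_subtype {i : ℕ | ω ∈ A i} (fun _ => (1 : ℝ≥0∞))]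
      rfl
    rw [this]
    exact Measurable.tsum fun i => measurable_one.indicator (hA i)
  refine measurable_to_countable' fun n => ?_
  convert h (measurableSet_singleton (n : ℝ≥0∞)) using 1
  ext ω
  simp

lemma measurable_powCount (a : ℝ≥0∞) : Measurable (powCount a) := measurable_of_countable _

lemma lintegral_powCount (P : Measure Ω) {N : Ω → ℕ∞} (hN : Measurable N) (a : ℝ≥0∞) :
    ∫⁻ ω, powCount a (N ω) ∂P = ∑' m : ℕ, a ^ m * P {ω | N ω = m} := by
  simp_rw [powCount_eq_tsum]
  have hm : ∀ m : ℕ, MeasurableSet {ω | N ω = m} := fun m => hN (measurableSet_singleton _)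
  have hi : ∀ m : ℕ, (fun ω => if N ω = m then a ^ m else 0) =
      {ω | N ω = m}.indicator fun _ => a ^ m := by
    intro m
    ext ω
    simp [Set.indicator_apply]
  rw [lintegral_tsum fun m => by
    rw [hi m]
    exact (measurable_const.indicator (hm m)).aemeasurable]
  refine tsum_congr fun m => ?_
  rw [hi m, lintegral_indicator_const (hm m)]

lemma tsum_pow_mul_poissonMeasure (r : ℝ≥0) {a : ℝ≥0∞} (ha : a ≤ 1) :
    ∑' m : ℕ, a ^ m * poissonMeasure r {m} = expNeg (r * (1 - a)) := by
  lift a to ℝ≥0 using ne_top_of_le_ne_top ENNReal.one_ne_top ha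
  have ha' : a ≤ 1 := by exact_mod_cast ha
  have h : HasSum (fun m : ℕ => Real.exp (-r) * ((r * a : ℝ) ^ m / m.factorial))
      (Real.exp (-r) * Real.exp (r * a)) := by
    have := NormedSpace.expSeries_div_hasSum_exp (r * a : ℝ)
    rw [← Real.exp_eq_exp_ℝ] at this
    exact this.mul_left _
  have ht : ∀ m : ℕ, (a : ℝ≥0∞) ^ m * poissonMeasure r {m} =
      ENNReal.ofReal (Real.exp (-r) * ((r * a : ℝ) ^ m / m.factorial)) := by
    intro m
    rw [poissonMeasure_singleton, ← ENNReal.ofReal_coe_nnreal,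
      ← ENNReal.ofReal_pow a.coe_nonneg, ← ENNReal.ofReal_mul (by positivity)]
    congr 1
    rw [mul_pow]
    ring
  simp_rw [ht]
  rw [← ENNReal.ofReal_tsum_of_nonneg (fun m => by positivity) h.summable, h.tsum_eq, expNeg,
    ← Real.exp_add]
  congr 2
  rw [ENNReal.toReal_mul, ENNReal.toReal_sub_of_le (by exact_mod_cast ha') (by simp)]
  simp
  ring

end Count

/-! ### Infinite products of factors at most 1 -/

/-- With factors at most 1 the partial products decrease, so their infimum serves as the infinite
product and no convergence condition is needed. -/
lemma iInf_prod_range_of_finite {w : ℕ → ℝ≥0∞} (hw : ∀ i, w i ≤ 1) (s : Finset ℕ)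
    (hs : ∀ i, i ∉ s → w i = 1) : ⨅ n, ∏ i ∈ Finset.range n, w i = ∏ i ∈ s, w i := by
  apply le_antisymm
  · obtain ⟨n, hn⟩ := s.exists_nat_subset_range
    refine (iInf_le _ n).trans (le_of_eq ?_)
    exact (Finset.prod_subset hn fun i _ hi => hs i hi).symm
  · refine le_iInf fun n => ?_
    rw [← Finset.prod_subset (Finset.inter_subset_right : s ∩ Finset.range n ⊆ _)
      fun i hi hi' => hs i fun h => hi' (Finset.mem_inter.2 ⟨h, hi⟩)]
    exact Finset.prod_le_prod_of_subset_of_le_one' Finset.inter_subset_left fun i _ _ => hw i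

lemma antitone_prod_range {w : ℕ → ℝ≥0∞} (hw : ∀ i, w i ≤ 1) :
    Antitone fun n => ∏ i ∈ Finset.range n, w i :=
  antitone_nat_of_succ_le fun n => by
    rw [Finset.prod_range_succ]
    exact mul_le_of_le_one_right' (hw n)

/-- For infinite `s`, any `k` of its indices bound the infimum by `v ^ k`, which tends to 0 because
`v < 1`; this matches the value of `powCount` at `⊤`. -/
lemma iInf_prod_range_ite (v : ℝ≥0∞) (hv : v < 1) (s : Set ℕ) [DecidablePred (· ∈ s)] :
    ⨅ n, ∏ i ∈ Finset.range n, (if i ∈ s then v else 1) = powCount v s.encard := by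
  by_cases hs : s.Finite
  · rw [iInf_prod_range_of_finite (fun i => by split_ifs <;> simp [hv.le]) hs.toFinset
      (fun i hi => by simpa using fun h => absurd h (by simpa using hi))]
    rw [Finset.prod_congr rfl (g := fun _ => v) (fun i hi => by simp_all), Finset.prod_const]
    rw [hs.encard_eq_coe_toFinset_card]
    simp [powCount]
  · have htop : s.encard = ⊤ := Set.encard_eq_top_iff.2 hs
    rw [htop, powCount, if_pos rfl]
    refine le_antisymm ?_ bot_le
    have h0 : Tendsto (fun k : ℕ => v ^ k) atTop (𝓝 0) :=
      ENNReal.tendsto_pow_atTop_nhds_zero_of_lt_one hv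
    refine ge_of_tendsto' h0 fun k => ?_
    obtain ⟨t, ht, hk⟩ := Set.Infinite.exists_subset_card_eq hs k
    obtain ⟨n, hn⟩ := t.exists_nat_subset_range
    refine (iInf_le _ n).trans ?_
    calc ∏ i ∈ Finset.range n, (if i ∈ s then v else 1)
        ≤ ∏ i ∈ t, (if i ∈ s then v else 1) :=
          Finset.prod_le_prod_of_subset_of_le_one' hn fun i _ _ => by split_ifs <;> simp [hv.le]
      _ = v ^ k := by
          rw [Finset.prod_congr rfl (g := fun _ => v) (fun i hi => if_pos (ht hi)),
            Finset.prod_const, hk]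


/-! ### Generating functional of a Poisson process -/

section Laplace

variable {Ω : Type*} [MeasurableSpace Ω] {P : Measure Ω} {d : ℕ} {lam : ℝ}
  {x : ℕ → Ω → EuclideanSpace ℝ (Fin d)}

lemma IsHomogeneousPoisson.measurable_pointCount (hx : IsHomogeneousPoisson P lam x)
    {B : Set (EuclideanSpace ℝ (Fin d))} (hB : MeasurableSet B) : Measurable (pointCount x B) :=
  measurable_encard_setOf_mem fun i => hx.measurable i hB

lemma IsHomogeneousPoisson.lintegral_powCount (hx : IsHomogeneousPoisson P lam x) (hlam : 0 ≤ lam)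
    {B : Set (EuclideanSpace ℝ (Fin d))} (hB : MeasurableSet B) (hB' : volume B ≠ ∞)
    {a : ℝ≥0∞} (ha : a ≤ 1) :
    ∫⁻ ω, powCount a (pointCount x B ω) ∂P =
      expNeg (ENNReal.ofReal lam * ((1 - a) * volume B)) := by
  rw [_root_.lintegral_powCount P (hx.measurable_pointCount hB)]
  simp_rw [hx.poisson B hB hB']
  rw [tsum_pow_mul_poissonMeasure _ ha]
  congr 1
  rw [← ENNReal.ofReal, ENNReal.ofReal_mul hlam, ENNReal.ofReal_toReal hB', mul_assoc,
    mul_comm (volume B)]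

/-- At `a = 1` the function `powCount` is the indicator of finiteness, and the generating function
equals 1 there. -/
lemma IsHomogeneousPoisson.ae_pointCount_ne_top [IsProbabilityMeasure P]
    (hx : IsHomogeneousPoisson P lam x) (hlam : 0 ≤ lam)
    {B : Set (EuclideanSpace ℝ (Fin d))} (hB : MeasurableSet B) (hB' : volume B ≠ ∞) :
    ∀ᵐ ω ∂P, pointCount x B ω ≠ ⊤ := by
  have h := hx.lintegral_powCount hlam hB hB' le_rfl
  have h2 : (fun ω => powCount 1 (pointCount x B ω)) =
      {ω | pointCount x B ω ≠ ⊤}.indicator 1 := by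
    ext ω
    by_cases h : pointCount x B ω = ⊤ <;> simp [powCount, h]
  have hm : MeasurableSet {ω | pointCount x B ω ≠ ⊤} :=
    (hx.measurable_pointCount hB (measurableSet_singleton ⊤)).compl
  rw [h2, lintegral_indicator_one hm] at h
  rw [ae_iff, ← Set.compl_ofPred, prob_compl_eq_zero_iff hm, h]
  simp [expNeg_zero]

/-- Grouping the points by the value `a` of `φ` turns the product into powers of `1 - a` whose
exponents are counts in disjoint level sets. These counts are independent Poisson variables, so the
mean is a product of exponentials. -/
lemma IsHomogeneousPoisson.lintegral_prod_simpleFunc [IsProbabilityMeasure P]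
    (hx : IsHomogeneousPoisson P lam x) (hlam : 0 ≤ lam)
    (φ : SimpleFunc (EuclideanSpace ℝ (Fin d)) ℝ≥0∞) (hφ : ∀ y, φ y ≤ 1)
    (hφ' : ∀ a, a ≠ 0 → volume (φ ⁻¹' {a}) ≠ ∞) :
    ∫⁻ ω, ⨅ n, ∏ i ∈ Finset.range n, (1 - φ (x i ω)) ∂P =
      expNeg (ENNReal.ofReal lam * ∫⁻ y, φ y) := by
  classical
  -- The value 0 is dropped: its level set may have infinite volume, but its points contribute the
  -- factor 1.
  set R : Finset ℝ≥0∞ := φ.range.erase 0 with hR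
  have hR0 : ∀ a ∈ R, a ≠ 0 := fun a ha => (Finset.mem_erase.1 ha).1
  have hR1 : ∀ a ∈ R, a ≤ 1 := by
    intro a ha
    obtain ⟨y, rfl⟩ := SimpleFunc.mem_range.1 (Finset.mem_erase.1 ha).2
    exact hφ y
  have hfin : ∀ᵐ ω ∂P, ∀ a ∈ R, pointCount x (φ ⁻¹' {a}) ω ≠ ⊤ := by
    rw [Filter.eventually_all_finset]
    exact fun a ha => hx.ae_pointCount_ne_top hlam (φ.measurableSet_fiber a) (hφ' a (hR0 a ha))
  have hprod : ∀ᵐ ω ∂P, ⨅ n, ∏ i ∈ Finset.range n, (1 - φ (x i ω)) =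
      ∏ a ∈ R, powCount (1 - a) (pointCount x (φ ⁻¹' {a}) ω) := by
    filter_upwards [hfin] with ω hω
    have hT : {i | φ (x i ω) ≠ 0}.Finite := by
      have : {i | φ (x i ω) ≠ 0} = ⋃ a ∈ R, {i | x i ω ∈ φ ⁻¹' {a}} := by
        ext i
        simp [hR]
      rw [this]
      exact R.finite_toSet.biUnion fun a ha => Set.encard_ne_top_iff.1 (hω a ha)
    rw [iInf_prod_range_of_finite (fun i => tsub_le_self) hT.toFinset
      (fun i hi => by
        have : φ (x i ω) = 0 := by simpa using hi
        simp [this]),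
      ← Finset.prod_fiberwise_of_maps_to (t := R) (g := fun i => φ (x i ω))
        (fun i hi => by
          have : φ (x i ω) ≠ 0 := by simpa using hi
          simp [hR, this])]
    refine Finset.prod_congr rfl fun a ha => ?_
    rw [Finset.prod_congr rfl (g := fun _ => 1 - a)
      (fun i hi => by rw [(Finset.mem_filter.1 hi).2]), Finset.prod_const, powCount,
      if_neg (hω a ha)]
    congr 1
    have : {i | x i ω ∈ φ ⁻¹' {a}} =
        ((hT.toFinset.filter fun i => φ (x i ω) = a : Finset ℕ) : Set ℕ) := by
      ext i
      simp only [Set.mem_preimage, Set.mem_singleton_iff, Set.mem_ofPred_eq, Finset.coe_filter,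
        Set.Finite.mem_toFinset]
      exact ⟨fun h => ⟨h ▸ hR0 a ha, h⟩, fun h => h.2⟩
    rw [pointCount, this, Set.encard_coe_eq_coe_finsetCard]
    rfl
  rw [lintegral_congr_ae hprod]
  -- The independence of counts is available for families indexed by `Fin m`, hence the reindexing.
  let e := R.equivFin
  let B : Fin R.card → Set (EuclideanSpace ℝ (Fin d)) := fun j => φ ⁻¹' {(e.symm j : ℝ≥0∞)}
  have hind : iIndepFun (fun j => pointCount x (B j)) P := by
    refine hx.indep R.card B (fun j => φ.measurableSet_fiber _)
      (fun j => hφ' _ (hR0 _ (e.symm j).2)) fun i j hij => ?_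
    refine Disjoint.preimage _ (Set.disjoint_singleton.2 fun h => hij ?_)
    exact e.symm.injective (Subtype.ext h)
  have hre : ∀ F : ℝ≥0∞ → ℝ≥0∞, ∏ a ∈ R, F a = ∏ j, F (e.symm j) := by
    intro F
    rw [← Finset.prod_coe_sort R F, ← e.symm.prod_comp]
  have hind' := hind.comp (fun j => powCount (1 - (e.symm j : ℝ≥0∞)))
    fun j => measurable_powCount _
  calc ∫⁻ ω, ∏ a ∈ R, powCount (1 - a) (pointCount x (φ ⁻¹' {a}) ω) ∂P
      = ∫⁻ ω, ∏ j, powCount (1 - (e.symm j : ℝ≥0∞)) (pointCount x (B j) ω) ∂P := by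
        refine lintegral_congr fun ω => ?_
        exact hre fun a => powCount (1 - a) (pointCount x (φ ⁻¹' {a}) ω)
    _ = ∏ j, ∫⁻ ω, powCount (1 - (e.symm j : ℝ≥0∞)) (pointCount x (B j) ω) ∂P :=
        lintegral_prod_eq_prod_lintegral_of_indepFun Finset.univ _ hind' fun j =>
          (measurable_powCount _).comp (hx.measurable_pointCount (φ.measurableSet_fiber _))
    _ = ∏ j, expNeg (ENNReal.ofReal lam * ((e.symm j : ℝ≥0∞) * volume (B j))) := by
        refine Finset.prod_congr rfl fun j _ => ?_
        rw [hx.lintegral_powCount hlam (φ.measurableSet_fiber _) (hφ' _ (hR0 _ (e.symm j).2))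
          tsub_le_self, ENNReal.sub_sub_cancel ENNReal.one_ne_top (hR1 _ (e.symm j).2)]
    _ = ∏ a ∈ R, expNeg (ENNReal.ofReal lam * (a * volume (φ ⁻¹' {a}))) :=
        (hre fun a => expNeg (ENNReal.ofReal lam * (a * volume (φ ⁻¹' {a})))).symm
    _ = expNeg (∑ a ∈ R, ENNReal.ofReal lam * (a * volume (φ ⁻¹' {a}))) := by
        rw [expNeg_sum]
        exact fun a ha => ENNReal.mul_ne_top ENNReal.ofReal_ne_top
          (ENNReal.mul_ne_top (ne_top_of_le_ne_top ENNReal.one_ne_top (hR1 a ha))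
            (hφ' a (hR0 a ha)))
    _ = expNeg (ENNReal.ofReal lam * ∫⁻ y, φ y) := by
        rw [SimpleFunc.lintegral_eq_lintegral, SimpleFunc.lintegral, ← Finset.mul_sum]
        congr 2
        exact Finset.sum_subset (Finset.erase_subset _ _) fun a ha ha' => by
          have : a = 0 := by
            by_contra h
            exact ha' (Finset.mem_erase.2 ⟨h, ha⟩)
          simp [this]

/-- The probability generating functional of a homogeneous Poisson process. -/
lemma IsHomogeneousPoisson.lintegral_prod [IsProbabilityMeasure P]
    (hx : IsHomogeneousPoisson P lam x) (hlam : 0 ≤ lam)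
    {u : EuclideanSpace ℝ (Fin d) → ℝ≥0∞} (hu : Measurable u) (hu1 : ∀ y, u y ≤ 1)
    (hu' : ∫⁻ y, u y ≠ ∞) :
    ∫⁻ ω, ⨅ n, ∏ i ∈ Finset.range n, (1 - u (x i ω)) ∂P =
      expNeg (ENNReal.ofReal lam * ∫⁻ y, u y) := by
  let φ : ℕ → SimpleFunc (EuclideanSpace ℝ (Fin d)) ℝ≥0∞ := SimpleFunc.eapprox u
  have hφle : ∀ m y, φ m y ≤ u y := fun m y => by
    rw [← SimpleFunc.iSup_eapprox_apply hu y]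
    exact le_iSup (fun m => φ m y) m
  have hφmono : ∀ y, Monotone fun m => φ m y := fun y m m' h => SimpleFunc.monotone_eapprox u h y
  have hφ1 : ∀ m y, φ m y ≤ 1 := fun m y => (hφle m y).trans (hu1 y)
  have hφt : ∀ y, Tendsto (fun m => φ m y) atTop (𝓝 (u y)) := fun y => by
    rw [← SimpleFunc.iSup_eapprox_apply hu y]
    exact tendsto_atTop_iSup (hφmono y)
  -- A level set of infinite volume at a nonzero value would make the integral of `u` infinite.
  have hφ' : ∀ m a, a ≠ 0 → volume (φ m ⁻¹' {a}) ≠ ∞ := by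
    intro m a ha h
    apply hu'
    rw [← top_le_iff]
    calc ∞ = a * volume (φ m ⁻¹' {a}) := by rw [h, ENNReal.mul_top ha]
      _ = ∫⁻ y in φ m ⁻¹' {a}, φ m y := by
        rw [setLIntegral_congr_fun (g := fun _ => a) ((φ m).measurableSet_fiber a)
          (fun y hy => hy), setLIntegral_const]
      _ ≤ ∫⁻ y, φ m y := setLIntegral_le_lintegral _ _
      _ ≤ ∫⁻ y, u y := lintegral_mono (hφle m)
  have hmeas : ∀ m n, Measurable fun ω => ∏ i ∈ Finset.range n, (1 - φ m (x i ω)) := fun m n =>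
    Finset.measurable_prod _ fun i _ =>
      ((φ m).measurable.comp (hx.measurable i)).const_sub _
  have hanti : ∀ ω n, Antitone fun m => ∏ i ∈ Finset.range n, (1 - φ m (x i ω)) :=
    fun ω n m m' h => Finset.prod_le_prod' fun i _ => tsub_le_tsub_left (hφmono _ h) _
  have hlim : ∀ ω n, ⨅ m, ∏ i ∈ Finset.range n, (1 - φ m (x i ω)) =
      ∏ i ∈ Finset.range n, (1 - u (x i ω)) := by
    intro ω n
    refine tendsto_nhds_unique (tendsto_atTop_iInf (hanti ω n)) ?_
    refine ENNReal.tendsto_finsetProd_of_ne_top _ (fun i _ => ?_)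
      fun i _ => ne_top_of_le_ne_top ENNReal.one_ne_top tsub_le_self
    exact ENNReal.Tendsto.sub tendsto_const_nhds (hφt _) (Or.inl ENNReal.one_ne_top)
  -- The limits in `n` and in `m` are both decreasing infima, so they commute, and monotone
  -- convergence moves the one in `m` outside the integral.
  have key : ∫⁻ ω, ⨅ n, ∏ i ∈ Finset.range n, (1 - u (x i ω)) ∂P =
      ⨅ m, ∫⁻ ω, ⨅ n, ∏ i ∈ Finset.range n, (1 - φ m (x i ω)) ∂P := by
    rw [← lintegral_iInf (fun m => Measurable.iInf fun n => hmeas m n)]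
    · refine lintegral_congr fun ω => ?_
      rw [iInf_comm]
      exact iInf_congr fun n => (hlim ω n).symm
    · exact fun m m' h ω => iInf_mono fun n => hanti ω n h
    · refine ne_top_of_le_ne_top (b := ∫⁻ _, 1 ∂P) (by simp) (lintegral_mono fun ω => ?_)
      exact (iInf_le _ 0).trans (by simp)
  have hA : Antitone fun m => ∫⁻ ω, ⨅ n, ∏ i ∈ Finset.range n, (1 - φ m (x i ω)) ∂P :=
    fun m m' h => lintegral_mono fun ω => iInf_mono fun n => hanti ω n h
  rw [key]
  refine tendsto_nhds_unique (tendsto_atTop_iInf hA) ?_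
  simp_rw [fun m => hx.lintegral_prod_simpleFunc hlam (φ m) (hφ1 m) (hφ' m)]
  refine tendsto_expNeg (ENNReal.mul_ne_top ENNReal.ofReal_ne_top hu') ?_
  refine ENNReal.Tendsto.const_mul ?_ (Or.inr ENNReal.ofReal_ne_top)
  exact lintegral_tendsto_of_tendsto_of_monotone (fun m => (φ m).measurable.aemeasurable)
    (ae_of_all _ hφmono) (ae_of_all _ hφt)

end Laplace

/-! ### Uniqueness of power series coefficients -/

/-- Bounded coefficients give radius of convergence at least 1, and (0, 1) accumulates at the centre
0, so the identity theorem applies. -/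
lemma powerSeries_coeff_unique {a b : ℕ → ℝ} (ha : ∀ n, ‖a n‖ ≤ 1) (hb : ∀ n, ‖b n‖ ≤ 1)
    (h : ∀ v : ℝ, 0 < v → v < 1 → ∑' n, a n * v ^ n = ∑' n, b n * v ^ n) : a = b := by
  have hr : ∀ c : ℕ → ℝ, (∀ n, ‖c n‖ ≤ 1) →
      HasFPowerSeriesAt (fun v => ∑' n, c n * v ^ n)
        (FormalMultilinearSeries.ofScalars ℝ c) 0 := by
    intro c hc
    have h1 : (1 : ℝ≥0∞) ≤ (FormalMultilinearSeries.ofScalars ℝ c).radius := by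
      refine FormalMultilinearSeries.le_radius_of_bound _ 1 (r := 1) fun n => ?_
      rw [FormalMultilinearSeries.ofScalars_norm]
      simpa using hc n
    have h2 := ((FormalMultilinearSeries.ofScalars ℝ c).hasFPowerSeriesOnBall
      (zero_lt_one.trans_le h1)).hasFPowerSeriesAt
    convert h2 using 1
    ext v
    rw [FormalMultilinearSeries.sum]
    simp [mul_comm]
  have hf : ∃ᶠ v in 𝓝[≠] (0 : ℝ), ∑' n, a n * v ^ n = ∑' n, b n * v ^ n := by
    have : ∀ᶠ v in 𝓝[>] (0 : ℝ), ∑' n, a n * v ^ n = ∑' n, b n * v ^ n := by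
      filter_upwards [Ioo_mem_nhdsGT zero_lt_one] with v hv using h v hv.1 hv.2
    exact this.frequently.filter_mono (nhdsWithin_mono _ fun v hv => ne_of_gt hv)
  have he := (AnalyticAt.frequently_eq_iff_eventually_eq (hr a ha).analyticAt
    (hr b hb).analyticAt).1 hf
  have := ((hr a ha).congr he).eq_formalMultilinearSeries (hr b hb)
  exact FormalMultilinearSeries.ofScalars_series_injective ℝ ℝ this

/-! ### Marking theorem -/

section Thinning

variable {Ω : Type*} [MeasurableSpace Ω] {P : Measure Ω}

/-- Both sides are coefficients of the same power series on (0, 1). Finiteness of `N` is not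
assumed, since `powCount` ignores the value `⊤`. -/
lemma measure_eq_poissonMeasure_of_lintegral_powCount [IsProbabilityMeasure P] {N : Ω → ℕ∞}
    (hN : Measurable N) (r : ℝ≥0)
    (h : ∀ v : ℝ≥0∞, v < 1 → ∫⁻ ω, powCount v (N ω) ∂P = expNeg (r * (1 - v))) (n : ℕ) :
    P {ω | N ω = n} = poissonMeasure r {n} := by
  have hone : ∀ q : ℝ≥0∞, q ≤ 1 → ‖q.toReal‖ ≤ 1 := fun q hq => by
    rw [Real.norm_of_nonneg ENNReal.toReal_nonneg]
    exact ENNReal.toReal_le_of_le_ofReal zero_le_one (by simpa using hq)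
  have key : (fun n : ℕ => (P {ω | N ω = n}).toReal) =
      fun n => (poissonMeasure r {n}).toReal := by
    refine powerSeries_coeff_unique (fun n => hone _ prob_le_one) (fun n => hone _ prob_le_one)
      fun v hv0 hv1 => ?_
    have hv : ENNReal.ofReal v < 1 := by simpa using hv1
    have h2 := h _ hv
    rw [lintegral_powCount P hN, ← tsum_pow_mul_poissonMeasure r hv.le] at h2
    have h3 := congrArg ENNReal.toReal h2
    rw [ENNReal.tsum_toReal_eq, ENNReal.tsum_toReal_eq] at h3
    · simpa [ENNReal.toReal_mul, ENNReal.toReal_ofReal hv0.le, mul_comm] using h3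
    · exact fun n => ENNReal.mul_ne_top (ENNReal.pow_ne_top ENNReal.ofReal_ne_top)
        (measure_ne_top _ _)
    · exact fun n => ENNReal.mul_ne_top (ENNReal.pow_ne_top ENNReal.ofReal_ne_top)
        (measure_ne_top _ _)
  exact (ENNReal.toReal_eq_toReal_iff' (measure_ne_top _ _) (measure_ne_top _ _)).1
    (congrFun key n)

/-- Fubini for the product law; this is what conditioning on the locations amounts to. -/
lemma ProbabilityTheory.IndepFun.lintegral_comp_prodMk [IsProbabilityMeasure P] {X Y : Type*}
    [MeasurableSpace X] [MeasurableSpace Y] {f : Ω → X} {g : Ω → Y} (hf : Measurable f)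
    (hg : Measurable g) (hfg : IndepFun f g P) {F : X × Y → ℝ≥0∞} (hF : Measurable F) :
    ∫⁻ ω, F (f ω, g ω) ∂P = ∫⁻ ω, ∫⁻ ω', F (f ω, g ω') ∂P ∂P := by
  have := Measure.isProbabilityMeasure_map (μ := P) hg.aemeasurable
  rw [← lintegral_map hF (hf.prodMk hg),
    (indepFun_iff_map_prod_eq_prod_map_map hf.aemeasurable hg.aemeasurable).1 hfg,
    lintegral_prod _ hF.aemeasurable, lintegral_map hF.lintegral_prod_right' hf]
  exact lintegral_congr fun ω => lintegral_map (hF.comp measurable_prodMk_left) hg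

lemma ProbabilityTheory.iIndepFun.lintegral_iInf_prod_range [IsProbabilityMeasure P]
    {g : ℕ → Ω → ℝ} (hg : ∀ i, Measurable (g i)) (hind : iIndepFun g P)
    {w : ℕ → ℝ → ℝ≥0∞} (hw : ∀ i, Measurable (w i)) (hw1 : ∀ i r, w i r ≤ 1) :
    ∫⁻ ω, ⨅ n, ∏ i ∈ Finset.range n, w i (g i ω) ∂P =
      ⨅ n, ∏ i ∈ Finset.range n, ∫⁻ ω, w i (g i ω) ∂P := by
  rw [lintegral_iInf (f := fun n ω => ∏ i ∈ Finset.range n, w i (g i ω))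
    (fun n => Finset.measurable_prod _ fun i _ => (hw i).comp (hg i))]
  · exact iInf_congr fun n => lintegral_prod_eq_prod_lintegral_of_indepFun (Finset.range n) _
      (hind.comp w hw) fun i => (hw i).comp (hg i)
  · exact fun m n hmn ω => antitone_prod_range (fun i => hw1 i (g i ω)) hmn
  · simp

variable {d : ℕ} {lam : ℝ} {x : ℕ → Ω → EuclideanSpace ℝ (Fin d)} {g : ℕ → Ω → ℝ}
  {ℓ : Measure ℝ}

/-- Marking theorem: the number of marked points in a measurable set of finite intensity is
Poisson distributed. -/
lemma IsHomogeneousPoisson.measure_encard_marked_eq [IsProbabilityMeasure P]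
    (hx : IsHomogeneousPoisson P lam x) (hlam : 0 ≤ lam) (hg : ∀ i, Measurable (g i))
    (hlaw : ∀ i, P.map (g i) = ℓ) (hind : iIndepFun g P)
    (hxg : IndepFun (fun ω i => x i ω) (fun ω i => g i ω) P)
    {S : Set (EuclideanSpace ℝ (Fin d) × ℝ)} (hS : MeasurableSet S) {r : ℝ≥0}
    (hr : ENNReal.ofReal lam * ∫⁻ y, ℓ (Prod.mk y ⁻¹' S) = r)
    (hfin : ∫⁻ y, ℓ (Prod.mk y ⁻¹' S) ≠ ∞) (n : ℕ) :
    P {ω | {i | (x i ω, g i ω) ∈ S}.encard = n} = poissonMeasure r {n} := by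
  classical
  have hℓ : IsProbabilityMeasure ℓ := hlaw 0 ▸ Measure.isProbabilityMeasure_map (hg 0).aemeasurable
  have hsec : ∀ y, MeasurableSet (Prod.mk y ⁻¹' S) := fun y => measurable_prodMk_left hS
  refine measure_eq_poissonMeasure_of_lintegral_powCount
    (measurable_encard_setOf_mem fun i => ((hx.measurable i).prodMk (hg i)) hS) r (fun v hv => ?_) n
  have hw : Measurable fun z : EuclideanSpace ℝ (Fin d) × ℝ => if z ∈ S then v else 1 :=
    Measurable.ite hS measurable_const measurable_const
  have hw1 : ∀ z : EuclideanSpace ℝ (Fin d) × ℝ, (if z ∈ S then v else 1) ≤ 1 := fun z => by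
    split_ifs <;> simp [hv.le]
  have hp : Measurable fun y => ℓ (Prod.mk y ⁻¹' S) := measurable_measure_prodMk_left hS
  -- Averaging over the mark of a point at `y`: it is counted, with factor `v`, with probability `ℓ
  -- (Prod.mk y ⁻¹' S)`, and otherwise has factor 1. Writing the mean as 1 minus a function of `y`
  -- fits the generating functional.
  have hone : ∀ i y, ∫⁻ ω, (if (y, g i ω) ∈ S then v else 1) ∂P =
      1 - (1 - v) * ℓ (Prod.mk y ⁻¹' S) := by
    intro i y
    rw [← lintegral_map (f := fun r => if (y, r) ∈ S then v else 1)
      (hw.comp measurable_prodMk_left) (hg i), hlaw i]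
    have hs : (fun r => if (y, r) ∈ S then v else 1) = fun r =>
        (Prod.mk y ⁻¹' S).indicator (fun _ => v) r +
          (Prod.mk y ⁻¹' S)ᶜ.indicator (fun _ => 1) r := by
      ext r
      by_cases h : (y, r) ∈ S <;> simp [h]
    rw [hs, lintegral_add_left (measurable_const.indicator (hsec y)),
      lintegral_indicator_const (hsec y), lintegral_indicator_const (hsec y).compl, one_mul]
    refine ENNReal.eq_sub_of_add_eq (ENNReal.mul_ne_top (by simp) (measure_ne_top _ _)) ?_
    rw [add_right_comm, ← add_mul, add_tsub_cancel_of_le hv.le, one_mul,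
      measure_add_measure_compl (hsec y), measure_univ]
  have hF : Measurable fun z : (ℕ → EuclideanSpace ℝ (Fin d)) × (ℕ → ℝ) =>
      ⨅ n, ∏ i ∈ Finset.range n, (if (z.1 i, z.2 i) ∈ S then v else 1) := by
    refine Measurable.iInf fun n => Finset.measurable_prod _ fun i _ => ?_
    exact hw.comp (((measurable_pi_apply i).comp measurable_fst).prodMk
      ((measurable_pi_apply i).comp measurable_snd))
  calc ∫⁻ ω, powCount v {i | (x i ω, g i ω) ∈ S}.encard ∂P
      = ∫⁻ ω, ⨅ n, ∏ i ∈ Finset.range n, (if (x i ω, g i ω) ∈ S then v else 1) ∂P :=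
        lintegral_congr fun ω => (iInf_prod_range_ite v hv {i | (x i ω, g i ω) ∈ S}).symm
    _ = ∫⁻ ω, ∫⁻ ω', ⨅ n, ∏ i ∈ Finset.range n,
          (if (x i ω, g i ω') ∈ S then v else 1) ∂P ∂P :=
        hxg.lintegral_comp_prodMk (measurable_pi_lambda _ hx.measurable)
          (measurable_pi_lambda _ hg) hF
    _ = ∫⁻ ω, ⨅ n, ∏ i ∈ Finset.range n,
          (1 - (1 - v) * ℓ (Prod.mk (x i ω) ⁻¹' S)) ∂P := by
        refine lintegral_congr fun ω => ?_
        rw [hind.lintegral_iInf_prod_range hg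
          (w := fun i r => if (x i ω, r) ∈ S then v else 1)
          (fun i => hw.comp measurable_prodMk_left) (fun i r => hw1 _)]
        simp_rw [hone]
    _ = expNeg (r * (1 - v)) := by
        rw [hx.lintegral_prod hlam (u := fun y => (1 - v) * ℓ (Prod.mk y ⁻¹' S))
          (hp.const_mul _) (fun y => mul_le_one' tsub_le_self prob_le_one),
          lintegral_const_mul _ hp, mul_left_comm, hr, mul_comm]
        rw [lintegral_const_mul _ hp]
        exact ENNReal.mul_ne_top (by simp) hfin

end Thinning

/-! ### Order statistics of a real sequence -/

section Order

variable {s : ℕ → ℝ}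

lemma exists_le_encard_setOf_le (s : ℕ → ℝ) (k : ℕ) :
    ∃ t, (k : ℕ∞) ≤ {i | s i ≤ t}.encard := by
  obtain ⟨t, ht⟩ := ((Finset.range k).image s).bddAbove
  refine ⟨t, ?_⟩
  calc (k : ℕ∞) = ((Finset.range k : Finset ℕ) : Set ℕ).encard := by
        rw [Set.encard_coe_eq_coe_finsetCard, Finset.card_range]
    _ ≤ _ := Set.encard_le_encard fun i hi => ht (by
        simpa using ⟨i, by simpa using hi, rfl⟩)

/-- If `k` terms lie below `t`, the largest of `k` such terms is itself a level below `t` with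
enough terms under it. Repetitions and accumulation of terms are allowed, which makes the
equivalence usable for measurability. -/
lemma kthSmallest_lt_iff (hs : ∀ i, 0 ≤ s i) {k : ℕ} (hk : 1 ≤ k) (t : ℝ) :
    kthSmallest s k < t ↔ (k : ℕ∞) ≤ {i | s i < t}.encard := by
  have hb : BddBelow {t : ℝ | (k : ℕ∞) ≤ {i : ℕ | s i ≤ t}.encard} := by
    refine ⟨0, fun t ht => ?_⟩
    have : {i | s i ≤ t}.Nonempty := by
      rw [← Set.one_le_encard_iff_nonempty]
      exact le_trans (by exact_mod_cast hk) ht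
    obtain ⟨i, hi⟩ := this
    exact (hs i).trans hi
  rw [kthSmallest, csInf_lt_iff hb (exists_le_encard_setOf_le s k)]
  constructor
  · rintro ⟨q, hq, hqt⟩
    exact le_trans hq (Set.encard_le_encard fun i hi => lt_of_le_of_lt hi hqt)
  · intro h
    obtain ⟨T, hT, hTk⟩ := Set.exists_subset_encard_eq h
    have hfin : T.Finite := Set.finite_of_encard_eq_coe hTk
    have hne : T.Nonempty := by
      rw [← Set.one_le_encard_iff_nonempty, hTk]
      exact_mod_cast hk
    obtain ⟨j, hj, hmax⟩ := Set.exists_max_image T s hfin hne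
    exact ⟨s j, hTk.symm.le.trans (Set.encard_le_encard fun i hi => hmax i hi), hT hj⟩

/-- Any level below `s i` loses the index `i`, hence, counts being finite, has fewer than `k` terms
under it. -/
lemma kthSmallest_eq_of_encard_eq (hfin : ∀ t, {i | s i ≤ t}.Finite) {i k : ℕ}
    (h : {j | s j ≤ s i}.encard = k) : kthSmallest s k = s i := by
  have : {t : ℝ | (k : ℕ∞) ≤ {j : ℕ | s j ≤ t}.encard} = Set.Ici (s i) := by
    ext t
    refine ⟨fun ht => ?_, fun ht => ?_⟩
    · by_contra hlt
      rw [Set.mem_Ici, not_le] at hlt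
      have hss : {j | s j ≤ t} ⊂ {j | s j ≤ s i} :=
        ⟨fun j hj => le_trans hj hlt.le, fun hsub =>
          absurd (hsub (show i ∈ {j | s j ≤ s i} from le_refl (s i))) (not_le.2 hlt)⟩
      exact absurd ((hfin t).encard_lt_encard hss) (not_lt.2 (h ▸ ht))
    · exact h.symm.le.trans (Set.encard_le_encard fun j hj => le_trans (show s j ≤ s i from hj) ht)
  rw [kthSmallest, this, csInf_Ici]

/-- Every rank is attained: the least term above a given level exists by finiteness and, by
injectivity, raises the count by exactly one. -/
lemma exists_encard_eq (hs : ∀ i, 0 ≤ s i) (hinj : Function.Injective s)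
    (hfin : ∀ t, {i | s i ≤ t}.Finite) (k : ℕ) :
    ∃ i, {j | s j ≤ s i}.encard = ((k + 1 : ℕ) : ℕ∞) := by
  have step : ∀ t, ∃ i, {j | s j ≤ s i}.encard = {j | s j ≤ t}.encard + 1 := by
    intro t
    obtain ⟨j₀, hj₀⟩ : ∃ j, t < s j := by
      by_contra! h
      exact Set.infinite_univ ((hfin t).subset fun j _ => h j)
    obtain ⟨i, hi, hmin⟩ := Set.exists_min_image {j | s j ≤ s j₀ ∧ t < s j} s
      ((hfin (s j₀)).subset fun j hj => hj.1) ⟨j₀, le_rfl, hj₀⟩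
    refine ⟨i, ?_⟩
    rw [← Set.encard_insert_of_notMem (a := i) (s := {j | s j ≤ t}) (not_le.2 hi.2)]
    congr 1
    ext j
    simp only [Set.mem_ofPred_eq, Set.mem_insert_iff]
    constructor
    · intro hj
      by_cases hjt : s j ≤ t
      · exact Or.inr hjt
      · exact Or.inl (hinj (le_antisymm hj (hmin j ⟨hj.trans hi.1, not_le.1 hjt⟩)))
    · rintro (rfl | hj)
      · exact le_rfl
      · exact hj.trans hi.2.le
  induction k with
  | zero =>
    -- The level -1 lies below every term, so the induction starts from count 0.
    obtain ⟨i, hi⟩ := step (-1)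
    refine ⟨i, ?_⟩
    have : {j | s j ≤ -1} = ∅ := by
      ext j
      simpa using (by linarith [hs j] : -1 < s j)
    rw [hi, this]
    simp
  | succ k ih =>
    obtain ⟨i, hi⟩ := ih
    obtain ⟨i', hi'⟩ := step (s i)
    exact ⟨i', by rw [hi', hi]; norm_cast⟩

lemma strictMonoOn_kthSmallest (hs : ∀ i, 0 ≤ s i) (hinj : Function.Injective s)
    (hfin : ∀ t, {i | s i ≤ t}.Finite) : StrictMonoOn (kthSmallest s) (Set.Ici 1) := by
  intro k hk l hl hkl
  obtain ⟨k, rfl⟩ := Nat.exists_eq_add_of_le' (Set.mem_Ici.1 hk)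
  obtain ⟨l, rfl⟩ := Nat.exists_eq_add_of_le' (Set.mem_Ici.1 hl)
  obtain ⟨i, hi⟩ := exists_encard_eq hs hinj hfin k
  obtain ⟨j, hj⟩ := exists_encard_eq hs hinj hfin l
  rw [kthSmallest_eq_of_encard_eq hfin hi, kthSmallest_eq_of_encard_eq hfin hj]
  by_contra! h
  have : {m | s m ≤ s j}.encard ≤ {m | s m ≤ s i}.encard :=
    Set.encard_le_encard fun m hm => le_trans hm h
  rw [hi, hj] at this
  exact absurd hkl (not_lt.2 (by exact_mod_cast this))

lemma image_kthSmallest (hs : ∀ i, 0 ≤ s i) (hinj : Function.Injective s)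
    (hfin : ∀ t, {i | s i ≤ t}.Finite) : kthSmallest s '' Set.Ici 1 = Set.range s := by
  ext t
  constructor
  · rintro ⟨k, hk, rfl⟩
    obtain ⟨k, rfl⟩ := Nat.exists_eq_add_of_le' (Set.mem_Ici.1 hk)
    obtain ⟨i, hi⟩ := exists_encard_eq hs hinj hfin k
    exact ⟨i, (kthSmallest_eq_of_encard_eq hfin hi).symm⟩
  · rintro ⟨i, rfl⟩
    have hc : {j | s j ≤ s i}.encard = ({j | s j ≤ s i}.ncard : ℕ) :=
      ((hfin _).cast_ncard_eq).symm
    refine ⟨_, ?_, kthSmallest_eq_of_encard_eq hfin hc⟩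
    exact (Set.ncard_pos (hfin _)).2 ⟨i, le_refl (s i)⟩

end Order

/-! ### Poisson sums, incomplete gamma function and the limiting density -/

section Gamma

/-- The probability that a Poisson variable of mean `x` is less than `k`. -/
def poissonCDFBelow (k : ℕ) (x : ℝ) : ℝ :=
  ∑ j ∈ Finset.range k, Real.exp (-x) * x ^ j / j.factorial

/-- The derivatives of consecutive terms telescope, leaving only the last one. -/
lemma hasDerivAt_poissonCDFBelow (n : ℕ) (x : ℝ) :
    HasDerivAt (poissonCDFBelow (n + 1)) (-(Real.exp (-x) * x ^ n / n.factorial)) x := by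
  have he : HasDerivAt (fun x : ℝ => Real.exp (-x)) (-Real.exp (-x)) x := by
    simpa using (hasDerivAt_neg x).exp
  induction n with
  | zero =>
    have : poissonCDFBelow (0 + 1) = fun x => Real.exp (-x) := by
      ext x
      simp [poissonCDFBelow]
    rw [this]
    simpa using he
  | succ n ih =>
    have : poissonCDFBelow (n + 1 + 1) = fun x =>
        poissonCDFBelow (n + 1) x + Real.exp (-x) * x ^ (n + 1) / (n + 1).factorial := by
      ext x
      simp only [poissonCDFBelow]
      rw [Finset.sum_range_succ]
    rw [this]
    refine (ih.add ((he.mul (hasDerivAt_pow (n + 1) x)).div_const _)).congr_deriv ?_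
    have h1 : ((n + 1).factorial : ℝ) = (n + 1) * n.factorial := by
      push_cast [Nat.factorial_succ]
      ring
    have h2 : (n.factorial : ℝ) ≠ 0 := by positivity
    have h3 : (n + 1 : ℝ) ≠ 0 := by positivity
    rw [h1]
    push_cast
    field_simp
    ring

lemma tendsto_poissonCDFBelow (k : ℕ) : Tendsto (poissonCDFBelow k) atTop (𝓝 0) := by
  have : Tendsto (poissonCDFBelow k) atTop (𝓝 (∑ j ∈ Finset.range k, 0)) := by
    refine tendsto_finsetSum _ fun j _ => ?_
    have := (Real.tendsto_pow_mul_exp_neg_atTop_nhds_zero j).div_const (j.factorial : ℝ)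
    simpa [mul_comm] using this
  simpa using this

/-- Integrate the telescoped derivative from `x` to infinity, where the Poisson sum vanishes. -/
lemma poissonCDFBelow_eq_upperIncompleteGamma {k : ℕ} (hk : 1 ≤ k) {x : ℝ} (hx : 0 ≤ x) :
    upperIncompleteGamma k x / Real.Gamma k = poissonCDFBelow k x := by
  obtain ⟨n, rfl⟩ := Nat.exists_eq_add_of_le' hk
  have h := integral_Ioi_of_hasDerivAt_of_nonpos' (a := x)
    (fun y _ => hasDerivAt_poissonCDFBelow n y)
    (fun y hy => by
      have : 0 < y := hx.trans_lt hy
      have : 0 ≤ Real.exp (-y) * y ^ n / n.factorial := by positivity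
      linarith) (tendsto_poissonCDFBelow (n + 1))
  rw [integral_neg, zero_sub, neg_inj] at h
  rw [← h, upperIncompleteGamma, ← integral_div]
  refine setIntegral_congr_fun measurableSet_Ioi fun t _ => ?_
  have : ((n + 1 : ℕ) : ℝ) - 1 = n := by push_cast; ring
  simp only [this]
  rw [Real.rpow_natCast]
  push_cast
  rw [Real.Gamma_nat_eq_factorial]
  ring

variable {A δ : ℝ} {k : ℕ}

lemma bestGainCDF_of_pos (hA : 0 ≤ A) (hk : 1 ≤ k) {z : ℝ} (hz : 0 < z) :
    bestGainCDF A δ k z = poissonCDFBelow k (A * z ^ (-δ)) := by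
  rw [bestGainCDF, if_pos hz, poissonCDFBelow_eq_upperIncompleteGamma hk (by positivity)]

lemma bestGainPDF_nonneg (hA : 0 ≤ A) (hδ : 0 ≤ δ) (hk : 1 ≤ k) (z : ℝ) :
    0 ≤ bestGainPDF A δ k z := by
  rw [bestGainPDF]
  split_ifs with hz
  · have : 0 < Real.Gamma k := Real.Gamma_pos_of_pos (by exact_mod_cast hk)
    positivity
  · exact le_rfl

lemma hasDerivAt_bestGainCDF (hA : 0 ≤ A) (hk : 1 ≤ k) {z : ℝ} (hz : 0 < z) :
    HasDerivAt (bestGainCDF A δ k) (bestGainPDF A δ k z) z := by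
  have hev : (fun z => poissonCDFBelow k (A * z ^ (-δ))) =ᶠ[𝓝 z] bestGainCDF A δ k := by
    filter_upwards [lt_mem_nhds hz] with y hy using (bestGainCDF_of_pos hA hk hy).symm
  refine HasDerivAt.congr_of_eventuallyEq ?_ hev.symm
  obtain ⟨n, rfl⟩ := Nat.exists_eq_add_of_le' hk
  have h1 : HasDerivAt (fun z : ℝ => A * z ^ (-δ)) (A * (-δ * z ^ (-δ - 1))) z :=
    (Real.hasDerivAt_rpow_const (Or.inl hz.ne')).const_mul A
  refine ((hasDerivAt_poissonCDFBelow n _).comp z h1).congr_deriv ?_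
  rw [bestGainPDF, if_pos hz, Real.rpow_sub_one hz.ne']
  push_cast
  rw [Real.Gamma_nat_eq_factorial, pow_succ, neg_mul]
  field_simp

lemma continuousOn_bestGainCDF (hA : 0 < A) (hδ : 0 < δ) (hk : 1 ≤ k) :
    ContinuousOn (bestGainCDF A δ k) (Set.Ici 0) := by
  intro z hz
  rcases (Set.mem_Ici.1 hz).eq_or_lt with rfl | hz
  -- At the left endpoint `A * z ^ (-δ)` tends to infinity, so the right limit agrees with the value
  -- 0 assigned there.
  · rw [← Set.Ioi_insert, continuousWithinAt_insert_self, ContinuousWithinAt]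
    have h0 : bestGainCDF A δ k 0 = 0 := by simp [bestGainCDF]
    rw [h0]
    have h1 : Tendsto (fun z : ℝ => A * z ^ (-δ)) (𝓝[>] 0) atTop :=
      (tendsto_rpow_neg_nhdsGT_zero (neg_lt_zero.2 hδ)).const_mul_atTop hA
    refine ((tendsto_poissonCDFBelow k).comp h1).congr' ?_
    filter_upwards [self_mem_nhdsWithin] with z hz using (bestGainCDF_of_pos hA.le hk hz).symm
  · exact (hasDerivAt_bestGainCDF hA.le hk hz).continuousAt.continuousWithinAt

lemma setLIntegral_Iic_bestGainPDF (hA : 0 < A) (hδ : 0 < δ) (hk : 1 ≤ k) (z : ℝ) :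
    ∫⁻ y in Set.Iic z, ENNReal.ofReal (bestGainPDF A δ k y) =
      ENNReal.ofReal (bestGainCDF A δ k z) := by
  have hzero : ∀ y : ℝ, y ≤ 0 → bestGainPDF A δ k y = 0 := fun y hy => if_neg (not_lt.2 hy)
  rcases le_or_gt z 0 with hz | hz
  · rw [setLIntegral_congr_fun (g := fun _ => 0) measurableSet_Iic fun y hy => by
      simp [hzero y (le_trans hy hz)]]
    simp [bestGainCDF, not_lt.2 hz]
  · have hcont := (continuousOn_bestGainCDF hA hδ hk).mono (t := Set.Icc 0 z) fun y hy => hy.1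
    have hd : ∀ y ∈ Set.Ioo 0 z, HasDerivAt (bestGainCDF A δ k) (bestGainPDF A δ k y) y :=
      fun y hy => hasDerivAt_bestGainCDF hA.le hk hy.1
    -- Integrability up to the endpoint 0 needs no estimate: a nonnegative derivative of a function
    -- continuous on the closed interval is integrable.
    have hint := intervalIntegral.integrableOn_deriv_of_nonneg hcont hd
      fun y _ => bestGainPDF_nonneg hA.le hδ.le hk y
    have hval := intervalIntegral.integral_eq_sub_of_hasDeriv_right_of_le hz.le hcont
      (fun y hy => (hd y hy).hasDerivWithinAt)
      ((intervalIntegrable_iff_integrableOn_Ioc_of_le hz.le).2 hint)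
    rw [← Set.Iic_union_Ioc_eq_Iic hz.le, lintegral_union measurableSet_Ioc
      (Set.Iic_disjoint_Ioc le_rfl),
      setLIntegral_congr_fun (g := fun _ => 0) measurableSet_Iic fun y hy => by
        simp [hzero y hy],
      ← ofReal_integral_eq_lintegral_ofReal hint
        (ae_of_all _ fun y => bestGainPDF_nonneg hA.le hδ.le hk y),
      ← intervalIntegral.integral_of_le hz.le, hval]
    simp [bestGainCDF]

end Gamma

/-! ### Moments of the fading law -/

section GainLaw

variable {α μ Om : ℝ}

lemma measurable_alphaMuGainPDF (α μ Om : ℝ) : Measurable (alphaMuGainPDF α μ Om) := by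
  unfold alphaMuGainPDF
  refine Measurable.ite measurableSet_Ioi ?_ measurable_const
  fun_prop

lemma alphaMuGainLaw_singleton (α μ Om r : ℝ) : alphaMuGainLaw α μ Om {r} = 0 :=
  withDensity_absolutelyContinuous _ _ (by simp)

lemma alphaMuGainLaw_Iic_zero (α μ Om : ℝ) : alphaMuGainLaw α μ Om (Set.Iic 0) = 0 := by
  rw [alphaMuGainLaw, withDensity_apply _ measurableSet_Iic,
    setLIntegral_congr_fun (g := fun _ => 0) measurableSet_Iic fun y hy => by
      simp [alphaMuGainPDF, not_lt.2 (Set.mem_Iic.1 hy)]]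
  simp

/-- The integrand is `C * r ^ q * exp (-b * r ^ (α / 2))` on the positive axis, a generalised gamma
integral. The case `δ = d / υ` is used for the mean count. -/
lemma lintegral_rpow_alphaMuGainLaw (hα : 0 < α) (hμ : 0 < μ) (hOm : 0 < Om) {δ : ℝ}
    (hδ : 0 ≤ δ) :
    ∫⁻ r, ENNReal.ofReal (r ^ δ) ∂alphaMuGainLaw α μ Om =
      ENNReal.ofReal (Om ^ δ * Real.Gamma (μ + 2 * δ / α) / Real.Gamma μ) := by
  set C : ℝ := α / (2 * Om ^ (α * μ / 2) * Real.Gamma μ) with hC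
  set q : ℝ := α * μ / 2 - 1 + δ with hq
  set b : ℝ := Om ^ (-(α / 2)) with hb
  have hΓ : 0 < Real.Gamma μ := Real.Gamma_pos_of_pos hμ
  have hCpos : 0 ≤ C := by positivity
  have hbpos : 0 < b := by positivity
  have hp : 0 < α / 2 := by positivity
  have hq1 : -1 < q := by
    have : 0 < α * μ / 2 := by positivity
    rw [hq]
    linarith
  have hint : IntegrableOn (fun r : ℝ => C * (r ^ q * Real.exp (-b * r ^ (α / 2))))
      (Set.Ioi 0) := (integrableOn_rpow_mul_exp_neg_mul_rpow hq1 hp hbpos).const_mul C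
  have hpt : ∀ r ∈ Set.Ioi (0 : ℝ),
      ENNReal.ofReal (alphaMuGainPDF α μ Om r) * ENNReal.ofReal (r ^ δ) =
        ENNReal.ofReal (C * (r ^ q * Real.exp (-b * r ^ (α / 2)))) := by
    intro r hr
    have hr : 0 < r := hr
    rw [← ENNReal.ofReal_mul' (by positivity), alphaMuGainPDF, if_pos hr, hq,
      Real.rpow_add hr _ δ, Real.div_rpow hr.le hOm.le, hb, Real.rpow_neg hOm.le, hC]
    congr 1
    rw [show -(Om ^ (α / 2))⁻¹ * r ^ (α / 2) = -(r ^ (α / 2) / Om ^ (α / 2)) by ring]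
    ring
  rw [alphaMuGainLaw, lintegral_withDensity_eq_lintegral_mul _
    (measurable_alphaMuGainPDF α μ Om).ennreal_ofReal (by fun_prop)]
  simp only [Pi.mul_apply]
  rw [← setLIntegral_eq_of_support_subset (s := Set.Ioi 0),
    setLIntegral_congr_fun measurableSet_Ioi hpt,
    ← ofReal_integral_eq_lintegral_ofReal hint, integral_const_mul,
    integral_rpow_mul_exp_neg_mul_rpow hp hq1 hbpos]
  · congr 1
    have h1 : (q + 1) / (α / 2) = μ + 2 * δ / α := by
      rw [hq]
      field_simp
      ring
    have h2 : b ^ (-(q + 1) / (α / 2)) = Om ^ (α * μ / 2) * Om ^ δ := by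
      rw [hb, ← Real.rpow_mul hOm.le, ← Real.rpow_add hOm, hq]
      congr 1
      field_simp
      ring
    rw [h1, h2, hC]
    have : Om ^ (α * μ / 2) ≠ 0 := by positivity
    field_simp
  · filter_upwards [ae_restrict_mem measurableSet_Ioi] with r hr
    have : 0 < r := hr
    positivity
  · intro r hr
    by_contra h
    exact hr (by simp [alphaMuGainPDF, show ¬ 0 < r from h])

end GainLaw

/-! ### Faded path losses of the network -/

section Network

variable {Ω : Type*} [MeasurableSpace Ω] {P : Measure Ω}

variable {d : ℕ} {lam υ α μ Om : ℝ} {x : ℕ → Ω → EuclideanSpace ℝ (Fin d)} {g : ℕ → Ω → ℝ}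

lemma IsFadingNetwork.measurable_fadedPathLoss (hnet : IsFadingNetwork P lam α μ Om x g) (i : ℕ) :
    Measurable (fadedPathLoss υ x g i) :=
  ((hnet.locations.measurable i).norm.pow_const υ).div (hnet.gain_measurable i)

lemma IsFadingNetwork.measurable_encard_fadedPathLoss_lt
    (hnet : IsFadingNetwork P lam α μ Om x g) (t : ℝ) :
    Measurable fun ω => {i | fadedPathLoss υ x g i ω < t}.encard :=
  measurable_encard_setOf_mem fun i => hnet.measurable_fadedPathLoss i measurableSet_Iio

lemma IsFadingNetwork.ae_gain_pos (hnet : IsFadingNetwork P lam α μ Om x g) :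
    ∀ᵐ ω ∂P, ∀ i, 0 < g i ω := by
  refine ae_all_iff.2 fun i => ?_
  have h := alphaMuGainLaw_Iic_zero α μ Om
  rw [← hnet.gain_law i, Measure.map_apply (hnet.gain_measurable i) measurableSet_Iic] at h
  rw [ae_iff]
  simpa using! h

variable [IsProbabilityMeasure P]

lemma ProbabilityTheory.IndepFun.measure_prodMk_mem_eq_zero {X Y : Type*}
    [MeasurableSpace X] [MeasurableSpace Y] {f : Ω → X} {g : Ω → Y} (hf : Measurable f)
    (hg : Measurable g) (hfg : IndepFun f g P) {W : Set (X × Y)} (hW : MeasurableSet W)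
    (h : ∀ a, P {ω | (a, g ω) ∈ W} = 0) : P {ω | (f ω, g ω) ∈ W} = 0 := by
  have h1 : ∀ u : Ω → X × Y, Measurable u →
      P {ω | u ω ∈ W} = ∫⁻ ω, W.indicator 1 (u ω) ∂P := fun u hu => by
    exact (lintegral_indicator_one (hu hW)).symm
  rw [h1 _ (hf.prodMk hg), hfg.lintegral_comp_prodMk hf hg (measurable_one.indicator hW)]
  simp_rw [← fun ω => h1 (fun ω' => (f ω, g ω')) (measurable_const.prodMk hg), h]
  simp

/-- For `d ≥ 1` the origin has volume 0, so the number of points there is Poisson of mean 0. -/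
lemma IsFadingNetwork.ae_location_ne_zero (hnet : IsFadingNetwork P lam α μ Om x g) (hd : 1 ≤ d) :
    ∀ᵐ ω ∂P, ∀ i, x i ω ≠ 0 := by
  have : Nonempty (Fin d) := ⟨⟨0, hd⟩⟩
  have hz : volume ({0} : Set (EuclideanSpace ℝ (Fin d))) = 0 := measure_singleton 0
  have h := hnet.locations.poisson {0} (measurableSet_singleton 0) (by simp [hz]) 0
  rw [hz, poissonMeasure_singleton] at h
  have h' : ∀ᵐ ω ∂P, pointCount x {0} ω = 0 := by
    have hm : MeasurableSet {ω | pointCount x {0} ω = 0} :=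
      hnet.locations.measurable_pointCount (measurableSet_singleton 0) (measurableSet_singleton 0)
    rw [ae_iff, ← Set.compl_ofPred, prob_compl_eq_zero_iff hm]
    simpa using h
  filter_upwards [h'] with ω hω i hi
  have : i ∈ {i | x i ω ∈ ({0} : Set (EuclideanSpace ℝ (Fin d)))} := hi
  rw [Set.encard_eq_zero.1 hω] at this
  exact this

lemma IsFadingNetwork.ae_fadedPathLoss_pos (hnet : IsFadingNetwork P lam α μ Om x g)
    (hd : 1 ≤ d) : ∀ᵐ ω ∂P, ∀ i, 0 < fadedPathLoss υ x g i ω := by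
  filter_upwards [hnet.ae_gain_pos, hnet.ae_location_ne_zero hd] with ω hg hx i
  have := norm_pos_iff.2 (hx i)
  have := hg i
  rw [fadedPathLoss]
  positivity

/-- Once `g j` is fixed, the independent variable `g i` would have to hit a single value, and its
law has no atoms. -/
lemma IsFadingNetwork.measure_gain_eq_const_mul_gain (hnet : IsFadingNetwork P lam α μ Om x g)
    {i j : ℕ} (hij : i ≠ j) (c : ℝ) : P {ω | g i ω = c * g j ω} = 0 := by
  refine (hnet.gain_indep.indepFun hij.symm).measure_prodMk_mem_eq_zero (hnet.gain_measurable j)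
    (hnet.gain_measurable i) (W := {z | z.2 = c * z.1})
    (measurableSet_eq_fun measurable_snd (measurable_fst.const_mul c)) fun a => ?_
  have h := alphaMuGainLaw_singleton α μ Om (c * a)
  rwa [← hnet.gain_law i,
    Measure.map_apply (hnet.gain_measurable i) (measurableSet_singleton _)] at h

/-- With the locations frozen, a tie forces a fixed ratio of two independent gains. Distinctness of
the locations plays no role. -/
lemma IsFadingNetwork.ae_injective_fadedPathLoss (hnet : IsFadingNetwork P lam α μ Om x g)
    (hd : 1 ≤ d) : ∀ᵐ ω ∂P, Function.Injective fun i => fadedPathLoss υ x g i ω := by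
  have key : ∀ i j, i ≠ j → ∀ᵐ ω ∂P, ¬ (fadedPathLoss υ x g i ω = fadedPathLoss υ x g j ω ∧
      (x i ω ≠ 0 ∧ x j ω ≠ 0) ∧ (g i ω ≠ 0 ∧ g j ω ≠ 0)) := by
    intro i j hij
    rw [ae_iff]
    simp only [not_not]
    -- The nonvanishing conditions belong to the event so that every section, for every choice of
    -- locations, is null despite division by zero; they are discharged almost surely at the end.
    let W : Set ((ℕ → EuclideanSpace ℝ (Fin d)) × (ℕ → ℝ)) :=
      {z | ‖z.1 i‖ ^ υ / z.2 i = ‖z.1 j‖ ^ υ / z.2 j ∧ (z.1 i ≠ 0 ∧ z.1 j ≠ 0) ∧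
        (z.2 i ≠ 0 ∧ z.2 j ≠ 0)}
    have hm1 : ∀ i, Measurable fun z : (ℕ → EuclideanSpace ℝ (Fin d)) × (ℕ → ℝ) => z.1 i :=
      fun i => (measurable_pi_apply i).comp measurable_fst
    have hm2 : ∀ i, Measurable fun z : (ℕ → EuclideanSpace ℝ (Fin d)) × (ℕ → ℝ) => z.2 i :=
      fun i => (measurable_pi_apply i).comp measurable_snd
    have hW : MeasurableSet W := by
      refine (measurableSet_eq_fun (((hm1 i).norm.pow_const υ).div (hm2 i))
        (((hm1 j).norm.pow_const υ).div (hm2 j))).inter (MeasurableSet.inter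
          (MeasurableSet.inter ?_ ?_) (MeasurableSet.inter ?_ ?_))
      · exact (hm1 i (measurableSet_singleton 0)).compl
      · exact (hm1 j (measurableSet_singleton 0)).compl
      · exact (hm2 i (measurableSet_singleton 0)).compl
      · exact (hm2 j (measurableSet_singleton 0)).compl
    refine hnet.indep.measure_prodMk_mem_eq_zero (W := W)
      (measurable_pi_lambda _ hnet.locations.measurable)
      (measurable_pi_lambda _ hnet.gain_measurable) hW fun a => ?_
    refine measure_mono_null ?_
      (hnet.measure_gain_eq_const_mul_gain hij (‖a i‖ ^ υ / ‖a j‖ ^ υ))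
    rintro ω ⟨h, ⟨hi, hj⟩, hgi, hgj⟩
    have hj' : 0 < ‖a j‖ ^ υ := Real.rpow_pos_of_pos (norm_pos_iff.2 hj) υ
    simp only at h hgi hgj
    rw [div_eq_div_iff hgi hgj] at h
    show g i ω = ‖a i‖ ^ υ / ‖a j‖ ^ υ * g j ω
    field_simp
    linarith
  have key' : ∀ᵐ ω ∂P, ∀ i j, i ≠ j →
      ¬ (fadedPathLoss υ x g i ω = fadedPathLoss υ x g j ω ∧
        (x i ω ≠ 0 ∧ x j ω ≠ 0) ∧ (g i ω ≠ 0 ∧ g j ω ≠ 0)) := by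
    simp only [ae_all_iff]
    exact key
  filter_upwards [key', hnet.ae_gain_pos, hnet.ae_location_ne_zero hd] with ω hω hg hx i j hij
  by_contra hne
  exact hω i j hne ⟨hij, ⟨hx i, hx j⟩, (hg i).ne', (hg j).ne'⟩

lemma volume_setOf_rpow_norm_div_lt (hd : 1 ≤ d) (hυ : 0 < υ) {t r : ℝ} (ht : 0 < t)
    (hr : 0 < r) :
    volume {y : EuclideanSpace ℝ (Fin d) | ‖y‖ ^ υ / r < t} =
      ENNReal.ofReal (unitBallVolume d * t ^ (d / υ)) * ENNReal.ofReal (r ^ (d / υ)) := by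
  have : Nonempty (Fin d) := ⟨⟨0, hd⟩⟩
  have hball : {y : EuclideanSpace ℝ (Fin d) | ‖y‖ ^ υ / r < t} =
      Metric.ball 0 ((t * r) ^ (1 / υ)) := by
    ext y
    rw [mem_ball_zero_iff, one_div, Real.lt_rpow_inv_iff_of_pos (norm_nonneg _) (by positivity) hυ,
      ← div_lt_iff₀ hr]
    rfl
  have hΓ : 0 < Real.Gamma (1 + (d : ℝ) / 2) := Real.Gamma_pos_of_pos (by positivity)
  rw [hball, EuclideanSpace.volume_ball, ← ENNReal.ofReal_pow (by positivity),
    ← ENNReal.ofReal_mul (by positivity), ← ENNReal.ofReal_mul' (by positivity), Fintype.card_fin]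
  congr 1
  rw [unitBallVolume, ← Real.rpow_natCast, ← Real.rpow_mul (by positivity),
    Real.mul_rpow ht.le hr.le, Real.sqrt_eq_rpow, ← Real.rpow_natCast (Real.pi ^ _),
    ← Real.rpow_mul Real.pi_pos.le, add_comm (1 : ℝ), one_div_mul_eq_div, one_div_mul_eq_div]
  ring

lemma Ab1_pos (hd : 1 ≤ d) (hυ : 0 < υ) (hlam : 0 < lam) (hα : 0 < α) (hμ : 0 < μ)
    (hOm : 0 < Om) : 0 < Ab1 d υ lam α μ Om := by
  have h1 : (0 : ℝ) < d := by exact_mod_cast hd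
  have h2 : 0 < Real.Gamma (1 + (d : ℝ) / 2) := Real.Gamma_pos_of_pos (by positivity)
  have h3 : 0 < Real.Gamma μ := Real.Gamma_pos_of_pos hμ
  have h4 : 0 < Real.Gamma (μ + 2 * (d / υ) / α) := Real.Gamma_pos_of_pos (by positivity)
  have := Real.pi_pos
  rw [Ab1, Ab0, unitBallVolume]
  positivity

/-- The number of users whose faded path loss is less than `t` is Poisson distributed. -/
lemma IsFadingNetwork.measure_encard_fadedPathLoss_lt (hnet : IsFadingNetwork P lam α μ Om x g)
    (hd : 1 ≤ d) (hυ : 0 < υ) (hlam : 0 < lam) (hα : 0 < α) (hμ : 0 < μ) (hOm : 0 < Om)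
    {t : ℝ} (ht : 0 < t) (n : ℕ) :
    P {ω | {i | fadedPathLoss υ x g i ω < t}.encard = n} =
      poissonMeasure (Ab1 d υ lam α μ Om * t ^ (d / υ)).toNNReal {n} := by
  have hℓ : IsProbabilityMeasure (alphaMuGainLaw α μ Om) :=
    hnet.gain_law 0 ▸ Measure.isProbabilityMeasure_map (hnet.gain_measurable 0).aemeasurable
  let S : Set (EuclideanSpace ℝ (Fin d) × ℝ) := {z | ‖z.1‖ ^ υ / z.2 < t}
  have hS : MeasurableSet S :=
    measurableSet_lt ((measurable_fst.norm.pow_const υ).div measurable_snd) measurable_const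
  have hδ : (0 : ℝ) < d / υ := div_pos (by exact_mod_cast hd) hυ
  have hΓ : 0 < Real.Gamma (1 + (d : ℝ) / 2) := Real.Gamma_pos_of_pos (by positivity)
  have hc : 0 ≤ unitBallVolume d := by
    rw [unitBallVolume]
    positivity
  have hmean : ∫⁻ y, alphaMuGainLaw α μ Om (Prod.mk y ⁻¹' S) =
      ENNReal.ofReal (unitBallVolume d * t ^ (d / υ)) * ENNReal.ofReal
        (Om ^ ((d : ℝ) / υ) * Real.Gamma (μ + 2 * (d / υ) / α) / Real.Gamma μ) := by
    -- Tonelli: for a fixed gain the section in space is a ball of explicit volume, which leaves a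
    -- moment of the gain law.
    rw [← Measure.prod_apply hS, Measure.prod_apply_symm hS,
      ← lintegral_rpow_alphaMuGainLaw hα hμ hOm hδ.le, ← lintegral_const_mul _ (by fun_prop)]
    refine lintegral_congr_ae ?_
    have hpos : ∀ᵐ r ∂alphaMuGainLaw α μ Om, 0 < r := by
      rw [ae_iff]
      simpa using! alphaMuGainLaw_Iic_zero α μ Om
    filter_upwards [hpos] with r hr
    exact volume_setOf_rpow_norm_div_lt hd hυ ht hr
  refine hnet.locations.measure_encard_marked_eq hlam.le hnet.gain_measurable hnet.gain_law
    hnet.gain_indep hnet.indep hS ?_ ?_ n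
  · rw [hmean, ← ENNReal.ofReal_mul (by positivity), ← ENNReal.ofReal_mul hlam.le,
      ← ENNReal.ofReal]
    congr 1
    rw [Ab1, Ab0]
    field_simp
  · rw [hmean]
    exact ENNReal.mul_ne_top ENNReal.ofReal_ne_top ENNReal.ofReal_ne_top

lemma IsFadingNetwork.measure_encard_fadedPathLoss_lt_lt
    (hnet : IsFadingNetwork P lam α μ Om x g)
    (hd : 1 ≤ d) (hυ : 0 < υ) (hlam : 0 < lam) (hα : 0 < α) (hμ : 0 < μ) (hOm : 0 < Om)
    {t : ℝ} (ht : 0 < t) (k : ℕ) :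
    P {ω | {i | fadedPathLoss υ x g i ω < t}.encard < k} =
      ENNReal.ofReal (poissonCDFBelow k (Ab1 d υ lam α μ Om * t ^ (d / υ))) := by
  have hA := Ab1_pos hd hυ hlam hα hμ hOm
  have hu : {ω | {i | fadedPathLoss υ x g i ω < t}.encard < (k : ℕ∞)} =
      ⋃ j ∈ Finset.range k, {ω | {i | fadedPathLoss υ x g i ω < t}.encard = j} := by
    ext ω
    simp only [Set.mem_ofPred_eq, Set.mem_iUnion, Finset.mem_range, exists_prop]
    constructor
    · intro h
      obtain ⟨m, hm⟩ := ENat.ne_top_iff_exists.1 (ne_top_of_lt h)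
      rw [← hm] at h ⊢
      exact ⟨m, by exact_mod_cast h, rfl⟩
    · rintro ⟨j, hj, h⟩
      rw [h]
      exact_mod_cast hj
  rw [hu, measure_biUnion_finset]
  · simp_rw [hnet.measure_encard_fadedPathLoss_lt hd hυ hlam hα hμ hOm ht,
      poissonMeasure_singleton]
    rw [poissonCDFBelow, ENNReal.ofReal_sum_of_nonneg fun j _ => by positivity]
    rw [Real.coe_toNNReal _ (by positivity)]
  · intro i _ j _ hij
    refine Set.disjoint_left.2 fun ω hi hj => hij ?_
    rw [Set.mem_ofPred_eq] at hi hj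
    have : (i : ℕ∞) = j := hi.symm.trans hj
    exact_mod_cast this
  · exact fun j _ => hnet.measurable_encard_fadedPathLoss_lt t (measurableSet_singleton _)

lemma IsFadingNetwork.ae_finite_fadedPathLoss_le (hnet : IsFadingNetwork P lam α μ Om x g)
    (hd : 1 ≤ d) (hυ : 0 < υ) (hlam : 0 < lam) (hα : 0 < α) (hμ : 0 < μ) (hOm : 0 < Om) :
    ∀ᵐ ω ∂P, ∀ t, {i | fadedPathLoss υ x g i ω ≤ t}.Finite := by
  -- Positive integer levels suffice, and there the Poisson weights of the finite counts already sum
  -- to 1.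
  have h : ∀ᵐ ω ∂P, ∀ n : ℕ, {i | fadedPathLoss υ x g i ω < n + 1}.encard ≠ ⊤ := by
    refine ae_all_iff.2 fun n => ?_
    have hN := hnet.measurable_encard_fadedPathLoss_lt (υ := υ) ((n : ℝ) + 1)
    have h1 := lintegral_powCount P hN 1
    simp_rw [hnet.measure_encard_fadedPathLoss_lt hd hυ hlam hα hμ hOm
      (show (0 : ℝ) < n + 1 by positivity)] at h1
    rw [tsum_pow_mul_poissonMeasure _ le_rfl, tsub_self, mul_zero, expNeg_zero] at h1
    have hm : MeasurableSet {ω | {i | fadedPathLoss υ x g i ω < n + 1}.encard ≠ ⊤} :=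
      (hN (measurableSet_singleton ⊤)).compl
    have h2 : (fun ω => powCount 1 {i | fadedPathLoss υ x g i ω < n + 1}.encard) =
        {ω | {i | fadedPathLoss υ x g i ω < n + 1}.encard ≠ ⊤}.indicator 1 := by
      ext ω
      by_cases h : {i | fadedPathLoss υ x g i ω < n + 1}.encard = ⊤
      · rw [Set.indicator_of_notMem (by simpa using h), powCount, if_pos h]
      · rw [Set.indicator_of_mem (by simpa using h), powCount, if_neg h]
        simp
    rw [h2, lintegral_indicator_one hm] at h1
    rwa [ae_iff, ← Set.compl_ofPred, prob_compl_eq_zero_iff hm]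
  filter_upwards [h] with ω hω t
  obtain ⟨n, hn⟩ := exists_nat_ge t
  exact (Set.encard_ne_top_iff.1 (hω n)).subset fun i hi =>
    lt_of_le_of_lt (le_trans hi hn) (lt_add_one _)

lemma measurable_kthSmallest {s : ℕ → Ω → ℝ} (hs : ∀ i, Measurable (s i))
    (hs0 : ∀ i ω, 0 ≤ s i ω) {k : ℕ} (hk : 1 ≤ k) :
    Measurable fun ω => kthSmallest (fun i => s i ω) k := by
  refine measurable_of_Iio fun t => ?_
  have : (fun ω => kthSmallest (fun i => s i ω) k) ⁻¹' Set.Iio t =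
      (fun ω => {i | s i ω < t}.encard) ⁻¹' Set.Ici (k : ℕ∞) := by
    ext ω
    exact kthSmallest_lt_iff (fun i => hs0 i ω) hk t
  rw [this]
  exact measurable_encard_setOf_mem (fun i => hs i measurableSet_Iio)
    (Set.to_countable _).measurableSet

lemma IsFadingNetwork.aemeasurable_bestPathLoss (hnet : IsFadingNetwork P lam α μ Om x g)
    (hd : 1 ≤ d) {k : ℕ} (hk : 1 ≤ k) : AEMeasurable (bestPathLoss υ x g k) P := by
  -- Path losses are nonnegative only almost surely; absolute values give a version to which
  -- `measurable_kthSmallest` applies.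
  refine ⟨fun ω => kthSmallest (fun i => |fadedPathLoss υ x g i ω|) k,
    measurable_kthSmallest (fun i => (hnet.measurable_fadedPathLoss i).norm)
      (fun i ω => abs_nonneg _) hk, ?_⟩
  filter_upwards [hnet.ae_fadedPathLoss_pos (υ := υ) hd] with ω hω
  rw [bestPathLoss]
  simp_rw [abs_of_pos (hω _)]

lemma IsFadingNetwork.ae_bestPathLoss_pos (hnet : IsFadingNetwork P lam α μ Om x g)
    (hd : 1 ≤ d) (hυ : 0 < υ) (hlam : 0 < lam) (hα : 0 < α) (hμ : 0 < μ) (hOm : 0 < Om)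
    {k : ℕ} (hk : 1 ≤ k) : ∀ᵐ ω ∂P, 0 < bestPathLoss υ x g k ω := by
  filter_upwards [hnet.ae_fadedPathLoss_pos hd, hnet.ae_injective_fadedPathLoss hd,
    hnet.ae_finite_fadedPathLoss_le hd hυ hlam hα hμ hOm] with ω hpos hinj hfin
  have : bestPathLoss υ x g k ω ∈ Set.range fun i => fadedPathLoss υ x g i ω := by
    rw [← image_kthSmallest (fun i => (hpos i).le) hinj hfin]
    exact ⟨k, hk, rfl⟩
  obtain ⟨i, hi⟩ := this
  exact hi ▸ hpos i

/-- The gain is at most `z` exactly when ξ_k is not below `z⁻¹`, that is, when fewer than `k` losses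
are strictly below `z⁻¹`. -/
lemma IsFadingNetwork.map_one_div_bestPathLoss_Iic (hnet : IsFadingNetwork P lam α μ Om x g)
    (hd : 1 ≤ d) (hυ : 0 < υ) (hlam : 0 < lam) (hα : 0 < α) (hμ : 0 < μ) (hOm : 0 < Om)
    {k : ℕ} (hk : 1 ≤ k) (z : ℝ) :
    P.map (fun ω => 1 / bestPathLoss υ x g k ω) (Set.Iic z) =
      ENNReal.ofReal (bestGainCDF (Ab1 d υ lam α μ Om) (d / υ) k z) := by
  have hm : AEMeasurable (fun ω => 1 / bestPathLoss υ x g k ω) P :=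
    (hnet.aemeasurable_bestPathLoss hd hk).const_div 1
  have hA := Ab1_pos hd hυ hlam hα hμ hOm
  rw [Measure.map_apply_of_aemeasurable hm measurableSet_Iic]
  rcases le_or_gt z 0 with hz | hz
  · rw [bestGainCDF, if_neg (not_lt.2 hz), ENNReal.ofReal_zero, ← compl_mem_ae_iff]
    filter_upwards [hnet.ae_bestPathLoss_pos hd hυ hlam hα hμ hOm hk] with ω hω
    simpa using hz.trans_lt (inv_pos.2 hω)
  · rw [bestGainCDF_of_pos hA.le hk hz, Real.rpow_neg hz.le, ← Real.inv_rpow hz.le,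
      ← hnet.measure_encard_fadedPathLoss_lt_lt hd hυ hlam hα hμ hOm (inv_pos.2 hz)]
    refine measure_congr ?_
    filter_upwards [hnet.ae_bestPathLoss_pos hd hυ hlam hα hμ hOm hk,
      hnet.ae_fadedPathLoss_pos (υ := υ) hd] with ω hω hpos
    refine propext ?_
    change 1 / bestPathLoss υ x g k ω ≤ z ↔ _ < (k : ℕ∞)
    rw [one_div, inv_le_comm₀ hω hz, ← not_lt, ← not_le (a := (k : ℕ∞))]
    exact not_congr (kthSmallest_lt_iff (fun i => (hpos i).le) hk _)

end Network

end

theorem lemma3 {Ω : Type*} [MeasurableSpace Ω] (P : Measure Ω) [IsProbabilityMeasure P]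
    (d : ℕ) (hd : 1 ≤ d) (υ lam α μ Om : ℝ) (hυ : 0 < υ) (hlam : 0 < lam) (hα : 0 < α)
    (hμ : 0 < μ) (hOm : 0 < Om)
    (x : ℕ → Ω → EuclideanSpace ℝ (Fin d)) (g : ℕ → Ω → ℝ)
    (hnet : IsFadingNetwork P lam α μ Om x g) :
    (∀ᵐ ω ∂P, StrictMonoOn (fun k => bestPathLoss υ x g k ω) (Set.Ici 1) ∧
      (fun k => bestPathLoss υ x g k ω) '' Set.Ici 1 =
        Set.range (fun i => fadedPathLoss υ x g i ω)) ∧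
    ∀ k : ℕ, 1 ≤ k →
      HasPDF (fun ω => 1 / bestPathLoss υ x g k ω) P volume ∧
      pdf (fun ω => 1 / bestPathLoss υ x g k ω) P volume =ᵐ[volume]
        (fun z => ENNReal.ofReal (bestGainPDF (Ab1 d υ lam α μ Om) (d / υ) k z)) ∧
      ∀ z : ℝ, cdf (P.map (fun ω => 1 / bestPathLoss υ x g k ω)) z =
        bestGainCDF (Ab1 d υ lam α μ Om) (d / υ) k z := by
  have hA := Ab1_pos hd hυ hlam hα hμ hOm
  have hδ : (0 : ℝ) < d / υ := div_pos (by exact_mod_cast hd) hυ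
  refine ⟨?_, fun k hk => ?_⟩
  · filter_upwards [hnet.ae_fadedPathLoss_pos hd, hnet.ae_injective_fadedPathLoss hd,
      hnet.ae_finite_fadedPathLoss_le hd hυ hlam hα hμ hOm] with ω hpos hinj hfin
    exact ⟨strictMonoOn_kthSmallest (fun i => (hpos i).le) hinj hfin,
      image_kthSmallest (fun i => (hpos i).le) hinj hfin⟩
  have hm : AEMeasurable (fun ω => 1 / bestPathLoss υ x g k ω) P :=
    (hnet.aemeasurable_bestPathLoss hd hk).const_div 1
  have hprob : IsProbabilityMeasure (P.map fun ω => 1 / bestPathLoss υ x g k ω) :=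
    Measure.isProbabilityMeasure_map hm
  have hIic := hnet.map_one_div_bestPathLoss_Iic hd hυ hlam hα hμ hOm hk
  have hf : Measurable fun z =>
      ENNReal.ofReal (bestGainPDF (Ab1 d υ lam α μ Om) (d / υ) k z) := by
    unfold bestGainPDF
    refine (Measurable.ite measurableSet_Ioi ?_ measurable_const).ennreal_ofReal
    fun_prop
  -- Agreement on the half-lines `Set.Iic z` identifies the law, so the distribution function yields
  -- the density.
  have hmap : P.map (fun ω => 1 / bestPathLoss υ x g k ω) = volume.withDensity fun z =>
      ENNReal.ofReal (bestGainPDF (Ab1 d υ lam α μ Om) (d / υ) k z) := by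
    refine Measure.ext_of_Iic _ _ fun z => ?_
    rw [hIic, withDensity_apply _ measurableSet_Iic, setLIntegral_Iic_bestGainPDF hA hδ hk]
  refine ⟨hasPDF_of_map_eq_withDensity hm _ hf.aemeasurable hmap, ?_, fun z => ?_⟩
  · rw [pdf_def, hmap]
    exact Measure.rnDeriv_withDensity _ hf
  · have hnn : 0 ≤ bestGainCDF (Ab1 d υ lam α μ Om) (d / υ) k z := by
      rcases le_or_gt z 0 with hz | hz
      · rw [bestGainCDF, if_neg (not_lt.2 hz)]
      · rw [bestGainCDF_of_pos hA.le hk hz, poissonCDFBelow]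
        positivity
    rw [cdf_eq_real, Measure.real, hIic, ENNReal.toReal_ofReal hnn]
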